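/- Work over $\mathbb F_2$. For a matrix $M\in\mathbb F_2^{m\times n}$ with rows $M_1,\dots,M_m$, a *cell-probe data structure for $M$ with space $s$ and $t$ probes* consists of an arbitrary (not necessarily linear) preprocessing map $\mathbb F_2^n\to\{0,1\}^s$, $X\mapsto U(X)$, and, for every $i\in[m]$, a deterministic decision tree of depth at most $t$ which adaptively probes the $s$ one-bit cells of $U(X)$ and outputs $\langle M_i,X\rangle$ for every $X\in\mathbb F_2^n$. All logarithms are to base $2$. **Theorem.** (1) There is an absolute constant $C$ such that the following holds for all integers $n\ge 0$ and $t,s,m\ge 100$ and every collection $\mathcal S\subseteq\mathbb F_2^n$. If $$m\ \ge\ C\cdot s\cdot 2^{3t}\qquad\text{and}\qquad \log|\mathcal S|\ \ge\ 40\cdot t\cdot\log s,$$ then there are $M_1,\dots,M_m\in\mathcal S$ (pairwise distinct if $m\le|\mathcal S|$) such that the matrix with rows $M_1,\dots,M_m$ has no cell-probe data structure with space $s$ and $t$ probes. (2) There is an absolute constant $c>0$ such that for every $\delta>0$ there is $K$ such that for all integers $n,m\ge 0$ and $s\ge K$ the following holds: with probability at least $1-\delta$ over a uniformly random $M\in\mathbb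 F_2^{m\times n}$, every cell-probe data structure for $M$ with space $s$ and $t$ probes satisfies $$t\ \ge\ c\cdot\min\Big\{\log\frac ms,\ \frac n{\log s}\Big\}.$$ (For $m\le s$ the bound is trivial.) -/

import Mathlib

/-- An adaptive query algorithm on a memory of `s` one-bit cells, as a decision tree: it either
stops with an answer in `𝔽₂`, or probes a cell and continues according to the bit it reads.
Computation between probes is free. -/
inductive ProbeTree (s : ℕ) : Type
  | answer (b : ZMod 2) : ProbeTree s
  | probe (cell : Fin s) (next : Bool → ProbeTree s) : ProbeTree s

namespace ProbeTree

/-- The worst-case number of probes (the depth of the decision tree). -/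
def depth {s : ℕ} : ProbeTree s → ℕ
  | answer _ => 0
  | probe _ next => max (depth (next false)) (depth (next true)) + 1

/-- The answer returned when the memory content is `u`. -/
def eval {s : ℕ} (u : Fin s → Bool) : ProbeTree s → ZMod 2
  | answer b => b
  | probe cell next => eval u (next (u cell))

end ProbeTree

/-- The linear operator `x ↦ M x` over `𝔽₂` has a static cell-probe data structure with `s` one-bit
cells and at most `t` adaptive probes per query: an arbitrary preprocessing map writes the `s` bits
from `x`, and for each row `i` a decision tree of depth at most `t` (which may depend on `M` and
`i`, but not on `x`) always outputs `⟨M i, x⟩`. -/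
def HasCellProbeDS {m n : ℕ} (M : Matrix (Fin m) (Fin n) (ZMod 2)) (s t : ℕ) : Prop :=
  ∃ (pre : (Fin n → ZMod 2) → Fin s → Bool) (alg : Fin m → ProbeTree s),
    ∀ i, (alg i).depth ≤ t ∧ ∀ x, (alg i).eval (pre x) = M i ⬝ᵥ x

/-! The proof counts matrices. Fix points `x j`, `j ∈ J`. A decision tree of depth `t` leads at
least a fraction `2⁻ᵗ` of the corresponding memory contents to one leaf. So if it answers the query
`v` correctly, then `v ⬝ᵥ x j` takes the answer at that leaf as a constant value on a large set of
indices `j`, and this set depends only on the memory contents and on the probes recorded along the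
path to the leaf. For suitably random points, fewer than `2 ^ (2t + 4)` vectors `v ∈ S` are constant
on any one large set: otherwise `2t + 4` of them would be linearly independent, and hence take
independent values at random points. Given the memory contents at all the points, each row of the
matrix is therefore one of at most `2 (2s + 1) ^ t * 2 ^ (2t + 4)` vectors, far fewer than `#S`,
whereas the memory contents carry only `s * #J` bits in total. -/

section CellProbe

open Finset

/-! ### Leaves of decision trees -/

/-- A record of at most `t` probes of a memory of `s` cells, each with the cell probed and the bit
read there. It describes a leaf of a decision tree; the entries `none` pad short records. -/
abbrev Transcript (s t : ℕ) : Type := Fin t → Option (Fin s × Bool)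

/-- The memory content `u` agrees with everything the transcript `P` records. -/
def Transcript.Consistent {s t : ℕ} (P : Transcript s t) (u : Fin s → Bool) : Prop :=
  ∀ i, ∀ a ∈ P i, u a.1 = a.2

instance {s t : ℕ} (P : Transcript s t) : DecidablePred P.Consistent := fun u =>
  inferInstanceAs (Decidable (∀ i, ∀ a ∈ P i, u a.1 = a.2))

lemma Transcript.consistent_cons_some {s t : ℕ} {c : Fin s} {a : Bool} {P : Transcript s t}
    {u : Fin s → Bool} :
    Transcript.Consistent (Fin.cons (some (c, a)) P : Transcript s (t + 1)) u ↔
      u c = a ∧ P.Consistent u := by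
  simp only [Transcript.Consistent, Fin.forall_fin_succ, Fin.cons_zero, Fin.cons_succ,
    Option.mem_some_iff, forall_eq']

lemma exists_card_le_two_mul_card_filter_eq {J : Type*} (A : Finset J) (f : J → Bool) :
    ∃ a, #A ≤ 2 * #{j ∈ A | f j = a} := by
  have hsum : #A = #{j ∈ A | f j = true} + #{j ∈ A | f j = false} := by
    rw [card_eq_sum_card_fiberwise fun j _ => mem_univ (f j), Fintype.sum_bool]
  by_contra! h
  linarith [h true, h false]

lemma ProbeTree.exists_transcript {s t : ℕ} {J : Type*} (T : ProbeTree s) (hT : T.depth ≤ t)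
    (u : J → Fin s → Bool) (A : Finset J) :
    ∃ (P : Transcript s t) (b : ZMod 2),
      #A ≤ 2 ^ t * #{j ∈ A | P.Consistent (u j)} ∧ ∀ w, P.Consistent w → T.eval w = b := by
  induction T generalizing t A with
  | answer b =>
    refine ⟨fun _ => none, b, ?_, fun _ _ => rfl⟩
    rw [filter_true_of_mem fun j _ => by simp [Transcript.Consistent]]
    exact Nat.le_mul_of_pos_left _ (by positivity)
  | probe c next ih =>
    obtain _ | t := t
    · simp [depth] at hT
    simp only [depth, add_le_add_iff_right, max_le_iff] at hT
    obtain ⟨a, ha⟩ := exists_card_le_two_mul_card_filter_eq A fun j => u j c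
    have hnext : (next a).depth ≤ t := by cases a <;> simp only [hT]
    obtain ⟨P, b, hcard, heval⟩ := ih a hnext {j ∈ A | u j c = a}
    refine ⟨Fin.cons (some (c, a)) P, b, ?_, fun w hw => ?_⟩
    · simp only [Transcript.consistent_cons_some, ← filter_filter]
      calc #A ≤ 2 * #{j ∈ A | u j c = a} := ha
        _ ≤ 2 * (2 ^ t * #{j ∈ {j ∈ A | u j c = a} | P.Consistent (u j)}) := by gcongr
        _ = _ := by ring
    · rw [Transcript.consistent_cons_some] at hw
      rw [eval, hw.1]
      exact heval w hw.2

/-! ### Linear equations at random points -/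

lemma choose_mul_self_le (a b : ℕ) : (a * b).choose b ≤ (4 * a) ^ b := by
  have hexp : (b : ℝ) ^ b / b.factorial ≤ 4 ^ b :=
    calc (b : ℝ) ^ b / b.factorial ≤ Real.exp b :=
          Real.pow_div_factorial_le_exp _ b.cast_nonneg b
      _ = Real.exp 1 ^ b := (Real.exp_one_pow b).symm
      _ ≤ 4 ^ b := by gcongr; linarith [Real.exp_one_lt_d9]
  have h : ((a * b).choose b : ℝ) ≤ (4 * a) ^ b :=
    calc ((a * b).choose b : ℝ) ≤ ((a * b : ℕ) : ℝ) ^ b / b.factorial := Nat.choose_le_pow_div b _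
      _ = a ^ b * (b ^ b / b.factorial) := by push_cast; ring
      _ ≤ a ^ b * 4 ^ b := by gcongr
      _ = (4 * a) ^ b := by ring
  exact_mod_cast h

lemma card_le_card_filter_mem_le {J D : Type*} [Fintype J] [DecidableEq J] [Fintype D]
    [DecidableEq D] (E : Finset D) (b : ℕ) :
    #{x : J → D | b ≤ #{j | x j ∈ E}} ≤
      (Fintype.card J).choose b * (#E ^ b * Fintype.card D ^ (Fintype.card J - b)) := by
  let box (A : Finset J) : Finset (J → D) := Fintype.piFinset fun j => if j ∈ A then E else univ
  have hbox : ∀ A ∈ powersetCard b (univ : Finset J),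
      #(box A) ≤ #E ^ b * Fintype.card D ^ (Fintype.card J - b) := fun A hA => by
    rw [← (mem_powersetCard.mp hA).2, Fintype.card_piFinset, ← card_compl]
    simp only [apply_ite card, prod_ite, prod_const, card_univ, filter_mem_eq_inter, univ_inter]
    rw [← compl_filter, filter_mem_eq_inter, univ_inter]
  have hcover : ({x : J → D | b ≤ #{j | x j ∈ E}} : Finset (J → D)) ⊆
      (powersetCard b univ).biUnion box := by
    intro x hx
    obtain ⟨A, hA, hAb⟩ := exists_subset_card_eq (mem_filter.mp hx).2
    refine mem_biUnion.mpr ⟨A, mem_powersetCard.mpr ⟨subset_univ A, hAb⟩, ?_⟩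
    refine Fintype.mem_piFinset.mpr fun j => ?_
    split_ifs with hj
    · exact (mem_filter.mp (hA hj)).2
    · exact mem_univ _
  simpa only [card_powersetCard, card_univ] using
    (card_le_card hcover).trans (card_biUnion_le_card_mul _ _ _ hbox)

section FiniteField

variable {F : Type*} [Field F] [Fintype F]

lemma exists_linearIndependent_of_pow_le_card {V : Type*} [AddCommGroup V] [Module F V]
    (A : Finset V) {r : ℕ} (hA : Fintype.card F ^ r ≤ #A) :
    ∃ v : Fin r → V, (∀ i, v i ∈ A) ∧ LinearIndependent F v := by
  have hspan : #A ≤ Fintype.card F ^ Set.finrank F (A : Set V) := by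
    have := Module.finite_of_finite F (M := Submodule.span F (A : Set V))
    rw [← Nat.card_eq_fintype_card, Set.finrank, ← Module.natCard_eq_pow_finrank,
      ← Set.ncard_coe_finset, ← Nat.card_coe_set_eq]
    exact Nat.card_mono (Set.toFinite _) Submodule.subset_span
  have hr : r ≤ Set.finrank F (A : Set V) :=
    (Nat.pow_le_pow_iff_right Fintype.one_lt_card).mp (hA.trans hspan)
  obtain ⟨v, hvA, -, hv⟩ := Submodule.exists_fun_fin_finrank_span_eq F (A : Set V)
  exact ⟨v ∘ Fin.castLE hr, fun i => hvA _, hv.comp _ (Fin.castLE_injective hr)⟩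

variable [DecidableEq F] {ι κ : Type*} [Fintype ι] [DecidableEq ι] [Fintype κ] {v : κ → ι → F}

lemma card_dotProduct_eq_mul (hv : LinearIndependent F v) (c : κ → F) :
    #{x : ι → F | ∀ i, v i ⬝ᵥ x = c i} * Fintype.card F ^ Fintype.card κ =
      Fintype.card (ι → F) := by
  classical
  let φ := (Matrix.of v).mulVecLin
  have hφ : Function.Surjective φ := by
    rw [← LinearMap.range_eq_top]
    refine Submodule.eq_top_of_finrank_eq ?_
    rw [Module.finrank_pi]
    exact LinearIndependent.rank_matrix hv
  have hfiber (d : κ → F) : #{x | φ x = d} = #{x | φ x = c} :=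
    AddMonoidHom.card_fiber_eq_of_mem_range φ (hφ d) (hφ c)
  calc #{x : ι → F | ∀ i, v i ⬝ᵥ x = c i} * Fintype.card F ^ Fintype.card κ
      = #{x | φ x = c} * Fintype.card (κ → F) := by
        simp only [Fintype.card_fun, funext_iff]; rfl
    _ = ∑ d : κ → F, #{x | φ x = d} := by
        simp only [hfiber, sum_const, card_univ, smul_eq_mul, mul_comm]
    _ = Fintype.card (ι → F) := (card_eq_sum_card_fiberwise fun x _ => mem_univ (φ x)).symm

lemma card_le_card_filter_dotProduct_eq_mul_le {J : Type*} [Fintype J] [DecidableEq J]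
    (hv : LinearIndependent F v) (c : κ → F) {a b : ℕ} (hJ : Fintype.card J = a * b) :
    #{x : J → ι → F | b ≤ #{j | ∀ i, v i ⬝ᵥ x j = c i}} *
        (Fintype.card F ^ Fintype.card κ) ^ b ≤
      (4 * a) ^ b * Fintype.card (J → ι → F) := by
  let E : Finset (ι → F) := {y | ∀ i, v i ⬝ᵥ y = c i}
  obtain hb | hb := lt_or_ge (Fintype.card J) b
  · have hempty : ∀ x : J → ι → F, ¬ b ≤ #{j | ∀ i, v i ⬝ᵥ x j = c i} := fun x =>
      not_le.mpr ((card_le_univ _).trans_lt hb)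
    simp only [hempty, filter_false, card_empty, zero_mul, zero_le]
  calc #{x : J → ι → F | b ≤ #{j | ∀ i, v i ⬝ᵥ x j = c i}} * (Fintype.card F ^ Fintype.card κ) ^ b
      = #{x : J → ι → F | b ≤ #{j | x j ∈ E}} * (Fintype.card F ^ Fintype.card κ) ^ b := by
        simp only [E, mem_filter_univ]
    _ ≤ (Fintype.card J).choose b * (#E ^ b * Fintype.card (ι → F) ^ (Fintype.card J - b)) *
          (Fintype.card F ^ Fintype.card κ) ^ b := by
        gcongr
        exact card_le_card_filter_mem_le E b
    _ = (Fintype.card J).choose b * ((#E * Fintype.card F ^ Fintype.card κ) ^ b *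
          Fintype.card (ι → F) ^ (Fintype.card J - b)) := by ring
    _ = (a * b).choose b * Fintype.card (J → ι → F) := by
        rw [card_dotProduct_eq_mul hv c, ← pow_add, Nat.add_sub_cancel' hb, ← hJ,
          Fintype.card_fun (α := J)]
    _ ≤ (4 * a) ^ b * Fintype.card (J → ι → F) := by
        gcongr
        exact choose_mul_self_le a b

end FiniteField

/-! ### List decoding from constant words -/

/-- The messages in `S` whose codeword under the linear code `v ↦ (v ⬝ᵥ x j)_j` takes the constant
value `b` on the set `A` of coordinates. -/
def constantOn {ι J : Type*} [Fintype ι] (S : Finset (ι → ZMod 2)) (x : J → ι → ZMod 2)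
    (A : Finset J) (b : ZMod 2) : Finset (ι → ZMod 2) :=
  {v ∈ S | ∀ j ∈ A, v ⬝ᵥ x j = b}

lemma mem_constantOn {ι J : Type*} [Fintype ι] {S : Finset (ι → ZMod 2)} {x : J → ι → ZMod 2}
    {A : Finset J} {b : ZMod 2} {v : ι → ZMod 2} :
    v ∈ constantOn S x A b ↔ v ∈ S ∧ ∀ j ∈ A, v ⬝ᵥ x j = b :=
  mem_filter

/-- The linear code `v ↦ (v ⬝ᵥ x j)_j` on the messages in `S` has fewer than `ℓ` codewords that
agree with a prescribed constant on a prescribed set of at least `κ` coordinates: list decodability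
from erasures, restricted to the constant received words. -/
def IsListDecodable {ι J : Type*} [Fintype ι] (S : Finset (ι → ZMod 2)) (x : J → ι → ZMod 2)
    (κ ℓ : ℕ) : Prop :=
  ∀ (A : Finset J) (b : ZMod 2), κ ≤ #A → #(constantOn S x A b) < ℓ

lemma exists_linearIndependent_of_not_isListDecodable {ι J : Type*} [Fintype ι] [Fintype J]
    {S : Finset (ι → ZMod 2)} {x : J → ι → ZMod 2} {κ r : ℕ}
    (hx : ¬ IsListDecodable S x κ (2 ^ r)) :
    ∃ (v : Fin r → ι → ZMod 2) (b : ZMod 2), (∀ i, v i ∈ S) ∧ LinearIndependent (ZMod 2) v ∧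
      κ ≤ #{j | ∀ i, v i ⬝ᵥ x j = b} := by
  obtain ⟨A, b, hA, hlist⟩ : ∃ A b, κ ≤ #A ∧ 2 ^ r ≤ #(constantOn S x A b) := by
    simpa only [IsListDecodable, not_forall, not_lt, exists_prop] using hx
  obtain ⟨v, hv, hind⟩ := exists_linearIndependent_of_pow_le_card (F := ZMod 2) _
    (hlist.trans_eq' (by rw [ZMod.card]))
  simp only [mem_constantOn] at hv
  refine ⟨v, b, fun i => (hv i).1, hind, hA.trans (card_le_card fun j hj => ?_)⟩
  exact mem_filter_univ _ |>.mpr fun i => (hv i).2 j hj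

lemma exists_isListDecodable {ι J : Type*} [Fintype ι] [Fintype J] (S : Finset (ι → ZMod 2))
    {q κ : ℕ} (t : ℕ) (hS : #S ≤ 2 ^ q) (hκ : 2 * q < κ) (hJ : Fintype.card J = 2 ^ t * κ) :
    ∃ x : J → ι → ZMod 2, IsListDecodable S x κ (2 ^ (2 * t + 4)) := by
  classical
  by_contra! hbad
  set r := 2 * t + 4 with hr
  let systems : Finset ((Fin r → ι → ZMod 2) × ZMod 2) :=
    {v ∈ Fintype.piFinset fun _ : Fin r => S | LinearIndependent (ZMod 2) v} ×ˢ univ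
  let popular (p : (Fin r → ι → ZMod 2) × ZMod 2) : Finset (J → ι → ZMod 2) :=
    {x | κ ≤ #{j | ∀ i, p.1 i ⬝ᵥ x j = p.2}}
  have hcover : (univ : Finset (J → ι → ZMod 2)) ⊆ systems.biUnion popular := fun x _ => by
    obtain ⟨v, b, hvS, hind, hcard⟩ := exists_linearIndependent_of_not_isListDecodable (hbad x)
    refine mem_biUnion.mpr ⟨(v, b), ?_, mem_filter_univ _ |>.mpr hcard⟩
    simpa [systems] using ⟨hvS, hind⟩
  have hsystems : #systems ≤ 2 ^ (q * r + 1) :=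
    calc #systems ≤ #S ^ r * 2 := by
          rw [card_product, card_univ, ZMod.card, ← Fintype.card_piFinset_const]
          gcongr
          exact filter_subset _ _
      _ ≤ (2 ^ q) ^ r * 2 := by gcongr
      _ = 2 ^ (q * r + 1) := by rw [← pow_mul, pow_succ]
  have hpopular : ∀ p ∈ systems, #(popular p) * 2 ^ (r * κ) ≤
      2 ^ ((t + 2) * κ) * Fintype.card (J → ι → ZMod 2) := fun p hp => by
    have hind : LinearIndependent (ZMod 2) p.1 := by
      simp only [systems, mem_product, mem_filter] at hp
      exact hp.1.2
    have h := card_le_card_filter_dotProduct_eq_mul_le hind (fun _ => p.2) hJ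
    rw [ZMod.card, Fintype.card_fin, ← pow_mul, show 4 * 2 ^ t = 2 ^ (t + 2) by ring,
      ← pow_mul] at h
    convert h
  have hpow : 2 ^ (r * κ) ≤ 2 ^ (q * r + 1) * 2 ^ ((t + 2) * κ) := by
    refine Nat.le_of_mul_le_mul_left ?_ (Fintype.card_pos (α := J → ι → ZMod 2))
    calc Fintype.card (J → ι → ZMod 2) * 2 ^ (r * κ)
        ≤ (∑ p ∈ systems, #(popular p)) * 2 ^ (r * κ) := by
          gcongr
          exact (card_le_card hcover).trans card_biUnion_le
      _ ≤ #systems * (2 ^ ((t + 2) * κ) * Fintype.card (J → ι → ZMod 2)) := by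
          rw [sum_mul]
          exact sum_le_card_nsmul _ _ _ hpopular
      _ ≤ 2 ^ (q * r + 1) * (2 ^ ((t + 2) * κ) * Fintype.card (J → ι → ZMod 2)) := by gcongr
      _ = _ := by ring
  rw [← pow_add, Nat.pow_le_pow_iff_right one_lt_two, hr] at hpow
  nlinarith

/-! ### Counting matrices with a data structure -/

open Classical in
lemma card_filter_exists_eval_eq_le {ι J : Type*} [Fintype ι] [Fintype J]
    {S : Finset (ι → ZMod 2)} {x : J → ι → ZMod 2} {s t κ ℓ : ℕ} (hx : IsListDecodable S x κ ℓ)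
    (hκ : 2 ^ t * κ ≤ Fintype.card J) (u : J → Fin s → Bool) :
    #{v ∈ S | ∃ T : ProbeTree s, T.depth ≤ t ∧ ∀ j, T.eval (u j) = v ⬝ᵥ x j} ≤
      2 * (2 * s + 1) ^ t * ℓ := by
  let popular : Finset (Transcript s t × ZMod 2) := {p | κ ≤ #{j | p.1.Consistent (u j)}}
  let answered (p : Transcript s t × ZMod 2) : Finset (ι → ZMod 2) :=
    constantOn S x {j | p.1.Consistent (u j)} p.2
  have hcover : {v ∈ S | ∃ T : ProbeTree s, T.depth ≤ t ∧ ∀ j, T.eval (u j) = v ⬝ᵥ x j} ⊆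
      popular.biUnion answered := by
    intro v hv
    obtain ⟨hvS, T, hT, heval⟩ := mem_filter.mp hv
    obtain ⟨P, b, hcard, hP⟩ := T.exists_transcript hT u univ
    refine mem_biUnion.mpr ⟨(P, b), mem_filter.mpr ⟨mem_univ _, ?_⟩, mem_constantOn.mpr ⟨hvS, ?_⟩⟩
    · exact Nat.le_of_mul_le_mul_left (hκ.trans hcard) (by positivity)
    · exact fun j hj => (heval j).symm.trans (hP _ (mem_filter.mp hj).2)
  have hpopular : #popular ≤ 2 * (2 * s + 1) ^ t :=
    calc #popular ≤ Fintype.card (Transcript s t × ZMod 2) := card_le_univ _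
      _ = 2 * (2 * s + 1) ^ t := by simp [mul_comm]
  calc _ ≤ #(popular.biUnion answered) := card_le_card hcover
    _ ≤ #popular * ℓ := card_biUnion_le_card_mul _ _ _ fun p hp =>
        (hx _ p.2 (mem_filter.mp hp).2).le
    _ ≤ 2 * (2 * s + 1) ^ t * ℓ := by gcongr

open Classical in
lemma ncard_hasCellProbeDS_le {n m s t κ ℓ : ℕ} {J : Type*} [Fintype J]
    {S : Finset (Fin n → ZMod 2)} {x : J → Fin n → ZMod 2} (hx : IsListDecodable S x κ ℓ)
    (hκ : 2 ^ t * κ ≤ Fintype.card J) :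
    {M : Matrix (Fin m) (Fin n) (ZMod 2) | (∀ i, M i ∈ S) ∧ HasCellProbeDS M s t}.ncard ≤
      (2 ^ s) ^ Fintype.card J * (2 * (2 * s + 1) ^ t * ℓ) ^ m := by
  let rows (u : J → Fin s → Bool) : Finset (Fin n → ZMod 2) :=
    {v ∈ S | ∃ T : ProbeTree s, T.depth ≤ t ∧ ∀ j, T.eval (u j) = v ⬝ᵥ x j}
  let matrices (u : J → Fin s → Bool) : Finset (Matrix (Fin m) (Fin n) (ZMod 2)) :=
    Fintype.piFinset fun _ => rows u
  have hcover : {M : Matrix (Fin m) (Fin n) (ZMod 2) | (∀ i, M i ∈ S) ∧ HasCellProbeDS M s t} ⊆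
      (univ.biUnion matrices : Finset _) := by
    intro M hM
    obtain ⟨hMS, pre, alg, halg⟩ := hM
    refine mem_coe.mpr <| mem_biUnion.mpr ⟨fun j => pre (x j), mem_univ _, ?_⟩
    refine Fintype.mem_piFinset.mpr fun i => ?_
    exact mem_filter.mpr ⟨hMS i, alg i, (halg i).1, fun j => (halg i).2 (x j)⟩
  have hrows : ∀ u ∈ (univ : Finset (J → Fin s → Bool)),
      #(matrices u) ≤ (2 * (2 * s + 1) ^ t * ℓ) ^ m := fun u _ => by
    refine (Fintype.card_piFinset_const (rows u) m).trans_le ?_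
    gcongr
    exact card_filter_exists_eval_eq_le hx hκ u
  calc _ ≤ #(univ.biUnion matrices) := by
        rw [← Set.ncard_coe_finset]
        exact Set.ncard_le_ncard hcover
    _ ≤ Fintype.card (J → Fin s → Bool) * (2 * (2 * s + 1) ^ t * ℓ) ^ m :=
        card_biUnion_le_card_mul _ _ _ hrows
    _ = (2 ^ s) ^ Fintype.card J * (2 * (2 * s + 1) ^ t * ℓ) ^ m := by
        rw [Fintype.card_fun, Fintype.card_fun, Fintype.card_bool, Fintype.card_fin]

lemma exists_le_two_pow_le_sq {N : ℕ} (hN : 2 ≤ N) : ∃ q, N ≤ 2 ^ q ∧ 2 ^ q ≤ N ^ 2 := by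
  refine ⟨Nat.log 2 N + 1, (Nat.lt_pow_succ_log_self one_lt_two N).le, ?_⟩
  rw [pow_succ, sq]
  exact Nat.mul_le_mul (Nat.pow_log_le_self 2 (by omega)) hN

lemma two_pow_mul_le_pow {N q : ℕ} (hq : q ≠ 0) (hqN : 2 ^ q ≤ N ^ 2) (w : ℕ) :
    2 ^ (w * (2 * q + 1)) ≤ N ^ (6 * w) :=
  calc 2 ^ (w * (2 * q + 1)) ≤ 2 ^ (w * (3 * q)) := by
        gcongr
        · norm_num
        · omega
    _ = (2 ^ q) ^ (3 * w) := by ring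
    _ ≤ (N ^ 2) ^ (3 * w) := by gcongr
    _ = N ^ (6 * w) := by ring

lemma two_mul_pow_mul_two_pow_le_pow {s t : ℕ} (ht : 1 ≤ t) (hs : 2 ≤ s) :
    2 * (2 * s + 1) ^ t * 2 ^ (2 * t + 4) ≤ s ^ (10 * t) :=
  calc 2 * (2 * s + 1) ^ t * 2 ^ (2 * t + 4) = (2 * s + 1) ^ t * 2 ^ (2 * t + 5) := by ring
    _ ≤ (s ^ 3) ^ t * 2 ^ (7 * t) := by
        gcongr
        · nlinarith [Nat.mul_le_mul hs hs]
        · norm_num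
        · omega
    _ ≤ (s ^ 3) ^ t * s ^ (7 * t) := by gcongr
    _ = s ^ (10 * t) := by ring

lemma sq_ncard_hasCellProbeDS_lt_pow {n m s t : ℕ} {S : Finset (Fin n → ZMod 2)} (ht : 1 ≤ t)
    (hs : 2 ≤ s) (hm : 32 * (s * 2 ^ t) ≤ m) (hS : s ^ (40 * t) ≤ #S) :
    {M : Matrix (Fin m) (Fin n) (ZMod 2) | (∀ i, M i ∈ S) ∧ HasCellProbeDS M s t}.ncard ^ 2 <
      #S ^ m := by
  have hS2 : 2 ≤ #S := hs.trans ((Nat.le_self_pow (by omega) s).trans hS)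
  obtain ⟨q, hSq, hqS⟩ := exists_le_two_pow_le_sq hS2
  have hq : q ≠ 0 := by rintro rfl; omega
  obtain ⟨x, hx⟩ := exists_isListDecodable (J := Fin (2 ^ t * (2 * q + 1))) S t hSq
    (Nat.lt_succ_self _) (by simp)
  have hcard := ncard_hasCellProbeDS_le (m := m) (s := s) (t := t) hx (by simp)
  rw [Fintype.card_fin] at hcard
  have hmemory : ((2 ^ s) ^ (2 ^ t * (2 * q + 1))) ^ 4 ≤ #S ^ (24 * (s * 2 ^ t)) :=
    calc ((2 ^ s) ^ (2 ^ t * (2 * q + 1))) ^ 4 = 2 ^ (4 * (s * 2 ^ t) * (2 * q + 1)) := by ring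
      _ ≤ #S ^ (6 * (4 * (s * 2 ^ t))) := two_pow_mul_le_pow hq hqS _
      _ = #S ^ (24 * (s * 2 ^ t)) := by ring
  have hrows : (2 * (2 * s + 1) ^ t * 2 ^ (2 * t + 4)) ^ 4 ≤ #S :=
    calc _ ≤ (s ^ (10 * t)) ^ 4 := by
          gcongr
          exact two_mul_pow_mul_two_pow_le_pow ht hs
      _ = s ^ (40 * t) := by ring
      _ ≤ #S := hS
  have hexponent : 24 * (s * 2 ^ t) + m < 2 * m := by
    have : 0 < s * 2 ^ t := by positivity
    omega
  refine lt_of_pow_lt_pow_left₀ 2 (Nat.zero_le _) ?_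
  calc _ ≤ (((2 ^ s) ^ (2 ^ t * (2 * q + 1)) *
          (2 * (2 * s + 1) ^ t * 2 ^ (2 * t + 4)) ^ m) ^ 2) ^ 2 := by gcongr
    _ = ((2 ^ s) ^ (2 ^ t * (2 * q + 1))) ^ 4 *
          ((2 * (2 * s + 1) ^ t * 2 ^ (2 * t + 4)) ^ 4) ^ m := by
        rw [← pow_mul, mul_pow, pow_right_comm _ m]
    _ ≤ #S ^ (24 * (s * 2 ^ t)) * #S ^ m := by gcongr
    _ = #S ^ (24 * (s * 2 ^ t) + m) := (pow_add _ _ _).symm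
    _ < #S ^ (2 * m) := Nat.pow_lt_pow_right hS2 hexponent
    _ = (#S ^ m) ^ 2 := by ring

/-! ### Hard rows in a collection -/

lemma pow_le_descFactorial_sq {N m : ℕ} (h : m ≤ N) : N ^ m ≤ N.descFactorial m ^ 2 := by
  have hreflect : N.descFactorial m = ∏ i ∈ range m, (N - (m - 1 - i)) := by
    rw [Nat.descFactorial_eq_prod_range, prod_range_reflect (fun i => N - i) m]
  calc N ^ m = ∏ _i ∈ range m, N := by simp only [prod_const, card_range]
    -- the two factors sum to at least `N + 1`
    _ ≤ ∏ i ∈ range m, (N - i) * (N - (m - 1 - i)) := prod_le_prod' fun i hi => by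
        have hi := mem_range.mp hi
        exact le_trans (by omega) (Nat.add_sub_one_le_mul (by omega) (by omega))
    _ = N.descFactorial m ^ 2 := by
        rw [prod_mul_distrib, ← hreflect, ← Nat.descFactorial_eq_prod_range, sq]

lemma ncard_injective_mem {α : Type*} (S : Finset α) (m : ℕ) :
    {f : Fin m → α | (∀ i, f i ∈ S) ∧ Function.Injective f}.ncard = (#S).descFactorial m := by
  have hrange : {f : Fin m → α | (∀ i, f i ∈ S) ∧ Function.Injective f} =
      Set.range fun (e : Fin m ↪ S) i => (e i : α) := by
    ext f
    constructor
    · rintro ⟨hS, hf⟩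
      exact ⟨⟨fun i => ⟨f i, hS i⟩, fun i j hij => hf (congrArg Subtype.val hij)⟩, rfl⟩
    · rintro ⟨e, rfl⟩
      exact ⟨fun i => (e i).2, Subtype.val_injective.comp e.injective⟩
  have hinj : Function.Injective fun (e : Fin m ↪ S) i => (e i : α) := fun e e' h => by
    ext i
    exact congrFun h i
  rw [hrange, ← Set.image_univ, Set.ncard_image_of_injective _ hinj, Set.ncard_univ,
    Nat.card_eq_fintype_card, Fintype.card_embedding_eq, Fintype.card_coe, Fintype.card_fin]

lemma ncard_forall_mem {α : Type*} (S : Finset α) (m : ℕ) :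
    {f : Fin m → α | ∀ i, f i ∈ S}.ncard = #S ^ m := by
  rw [← Fintype.card_piFinset_const, ← Set.ncard_coe_finset]
  congr 1
  ext f
  simp

lemma exists_not_hasCellProbeDS {n m s t : ℕ} {S : Finset (Fin n → ZMod 2)} (ht : 1 ≤ t)
    (hs : 2 ≤ s) (hm : 32 * (s * 2 ^ t) ≤ m) (hS : s ^ (40 * t) ≤ #S) :
    ∃ M : Matrix (Fin m) (Fin n) (ZMod 2),
      (∀ i, M i ∈ S) ∧ (m ≤ #S → Function.Injective M) ∧ ¬ HasCellProbeDS M s t := by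
  by_contra! hall
  let easy : Set (Matrix (Fin m) (Fin n) (ZMod 2)) := {M | (∀ i, M i ∈ S) ∧ HasCellProbeDS M s t}
  suffices hmany : #S ^ m ≤ easy.ncard ^ 2 from
    (sq_ncard_hasCellProbeDS_lt_pow ht hs hm hS).not_ge hmany
  obtain hmS | hmS := le_or_gt m #S
  · have hinj : {M : Matrix (Fin m) (Fin n) (ZMod 2) | (∀ i, M i ∈ S) ∧ Function.Injective M} ⊆
        easy := fun M hM => ⟨hM.1, hall M hM.1 fun _ => hM.2⟩
    calc #S ^ m ≤ (#S).descFactorial m ^ 2 := pow_le_descFactorial_sq hmS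
      _ ≤ easy.ncard ^ 2 := by
          gcongr
          exact (ncard_injective_mem S m).symm.trans_le (Set.ncard_le_ncard hinj)
  · have hmem : {M : Matrix (Fin m) (Fin n) (ZMod 2) | ∀ i, M i ∈ S} ⊆ easy := fun M hM =>
      ⟨hM, hall M hM fun h => absurd h hmS.not_ge⟩
    calc #S ^ m ≤ easy.ncard :=
          (ncard_forall_mem S m).symm.trans_le (Set.ncard_le_ncard hmem)
      _ ≤ easy.ncard ^ 2 := Nat.le_self_pow two_ne_zero _

/-! ### Random matrices -/

namespace HasCellProbeDS

variable {n m s t t' : ℕ} {M : Matrix (Fin m) (Fin n) (ZMod 2)}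

lemma mono (h : HasCellProbeDS M s t) (htt' : t ≤ t') : HasCellProbeDS M s t' := by
  obtain ⟨pre, alg, halg⟩ := h
  exact ⟨pre, alg, fun i => ⟨(halg i).1.trans htt', (halg i).2⟩⟩

lemma eq_zero (h : HasCellProbeDS M s 0) : M = 0 := by
  obtain ⟨pre, alg, halg⟩ := h
  ext i j
  obtain ⟨hdepth, heval⟩ := halg i
  cases hT : alg i with
  | probe c next => simp [hT, ProbeTree.depth] at hdepth
  | answer b =>
    simp only [hT, ProbeTree.eval] at heval
    have hb : b = 0 := by simpa only [dotProduct_zero] using heval 0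
    rw [Matrix.zero_apply, ← mul_one (M i j), ← dotProduct_single, ← heval, hb]

end HasCellProbeDS

lemma sq_ncard_hasCellProbeDS_lt_two_pow {n m s t : ℕ} (hs : 2 ≤ s) (hm : s * 2 ^ (40 * t) < m)
    (hn : s ^ (40 * t) < 2 ^ n) :
    {M : Matrix (Fin m) (Fin n) (ZMod 2) | HasCellProbeDS M s t}.ncard ^ 2 < 2 ^ (n * m) := by
  obtain rfl | ht := Nat.eq_zero_or_pos t
  · have hzero : {M : Matrix (Fin m) (Fin n) (ZMod 2) | HasCellProbeDS M s 0} ⊆ {0} :=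
      fun M hM => HasCellProbeDS.eq_zero hM
    have hn0 : n ≠ 0 := by rintro rfl; simp at hn
    calc _ ≤ ({0} : Set (Matrix (Fin m) (Fin n) (ZMod 2))).ncard ^ 2 := by
          gcongr
          exact Set.toFinite _
      _ = 1 := by rw [Set.ncard_singleton, one_pow]
      _ < 2 ^ (n * m) := Nat.one_lt_two_pow (mul_ne_zero hn0 (by omega))
  · have hcard : #(univ : Finset (Fin n → ZMod 2)) = 2 ^ n := by
      rw [card_univ, Fintype.card_fun, ZMod.card, Fintype.card_fin]
    have hm' : 32 * (s * 2 ^ t) ≤ m :=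
      calc 32 * (s * 2 ^ t) = s * 2 ^ (t + 5) := by ring
        _ ≤ s * 2 ^ (40 * t) := by gcongr <;> omega
        _ ≤ m := hm.le
    have h := sq_ncard_hasCellProbeDS_lt_pow ht hs hm' (hn.le.trans hcard.ge)
    simpa only [mem_univ, implies_true, true_and, hcard, ← pow_mul] using h

lemma pow_le_of_mul_logb_le_logb {s N k : ℕ} (hk : k ≠ 0) (hs : 2 ≤ s)
    (h : k * Real.logb 2 s ≤ Real.logb 2 N) : s ^ k ≤ N := by
  have hlog : 0 < Real.logb 2 N :=
    h.trans_lt' (mul_pos (by positivity) (Real.logb_pos one_lt_two (by exact_mod_cast hs)))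
  have hN : (0 : ℝ) < N := Nat.cast_pos.mpr <| Nat.pos_of_ne_zero <| by rintro rfl; simp at hlog
  rw [← Real.logb_pow, Real.logb_le_logb one_lt_two (by positivity) hN] at h
  exact_mod_cast h

lemma mul_two_pow_lt_of_lt_logb_div {m s k : ℕ} (hs : 0 < s) (h : k < Real.logb 2 (m / s)) :
    s * 2 ^ k < m := by
  have hm : (0 : ℝ) < m := Nat.cast_pos.mpr <| Nat.pos_of_ne_zero <| by
    rintro rfl
    exact absurd h (by simp)
  rw [Real.lt_logb_iff_rpow_lt one_lt_two (by positivity), Real.rpow_natCast,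
    lt_div_iff₀' (by positivity)] at h
  exact_mod_cast h

lemma pow_lt_two_pow_of_lt_div_logb {n s k : ℕ} (hs : 2 ≤ s) (h : k < n / Real.logb 2 s) :
    s ^ k < 2 ^ n := by
  rw [lt_div_iff₀ (Real.logb_pos one_lt_two (by exact_mod_cast hs)), ← Real.logb_pow,
    Real.logb_lt_iff_lt_rpow one_lt_two (by positivity), Real.rpow_natCast] at h
  exact_mod_cast h

lemma one_sub_mul_card_le_ncard_compl {α : Type*} [Finite α] {A : Set α} {δ : ℝ} (hδ : 0 < δ)
    (hA : A.ncard ^ 2 ≤ Nat.card α) (hcard : 1 / δ ^ 2 ≤ Nat.card α) :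
    (1 - δ) * Nat.card α ≤ Aᶜ.ncard := by
  have hsmall : (A.ncard : ℝ) ≤ δ * Nat.card α := by
    refine (pow_le_pow_iff_left₀ (by positivity) (by positivity) two_ne_zero).mp ?_
    calc (A.ncard : ℝ) ^ 2 ≤ Nat.card α := by exact_mod_cast hA
      _ ≤ δ ^ 2 * Nat.card α * Nat.card α :=
          le_mul_of_one_le_left (by positivity) ((div_le_iff₀' (by positivity)).mp hcard)
      _ = (δ * Nat.card α) ^ 2 := by ring
  have hsum : (A.ncard : ℝ) + Aᶜ.ncard = Nat.card α := by exact_mod_cast A.ncard_add_ncard_compl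
  linarith

lemma card_matrix_zmod_two (m n : ℕ) :
    Nat.card (Matrix (Fin m) (Fin n) (ZMod 2)) = 2 ^ (n * m) := by
  rw [Nat.card_congr Matrix.of.symm, Nat.card_fun, Nat.card_fun, Nat.card_zmod, Nat.card_fin,
    Nat.card_fin, pow_mul]

lemma one_sub_mul_card_le_ncard_not_hasCellProbeDS {n m s t : ℕ} {δ : ℝ} (hδ : 0 < δ) (hs : 2 ≤ s)
    (hδs : 1 / δ ^ 2 ≤ s) (hm : s * 2 ^ (40 * t) < m) (hn : s ^ (40 * t) < 2 ^ n) :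
    (1 - δ) * Nat.card (Matrix (Fin m) (Fin n) (ZMod 2)) ≤
      {M : Matrix (Fin m) (Fin n) (ZMod 2) | ¬ HasCellProbeDS M s t}.ncard := by
  have hcard : s ≤ Nat.card (Matrix (Fin m) (Fin n) (ZMod 2)) := by
    have hn0 : 0 < n := Nat.pos_of_ne_zero <| by
      rintro rfl
      exact hn.not_ge (Nat.one_le_pow _ _ (by omega))
    calc s ≤ s * 2 ^ (40 * t) := Nat.le_mul_of_pos_right s (by positivity)
      _ ≤ 2 ^ m := hm.le.trans m.lt_two_pow_self.le
      _ ≤ 2 ^ (n * m) := Nat.pow_le_pow_right two_pos (Nat.le_mul_of_pos_left m hn0)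
      _ = _ := (card_matrix_zmod_two m n).symm
  exact one_sub_mul_card_le_ncard_compl hδ
    ((sq_ncard_hasCellProbeDS_lt_two_pow hs hm hn).le.trans_eq (card_matrix_zmod_two m n).symm)
    (hδs.trans (by exact_mod_cast hcard))

lemma one_sub_mul_card_le_card_forall_hasCellProbeDS_imp_le {n m s : ℕ} {δ : ℝ} (hδ : 0 < δ)
    (hs : 2 ≤ s) (hδs : 1 / δ ^ 2 ≤ s) :
    (1 - δ) * Nat.card (Matrix (Fin m) (Fin n) (ZMod 2)) ≤
      Nat.card {M : Matrix (Fin m) (Fin n) (ZMod 2) // ∀ t : ℕ, HasCellProbeDS M s t →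
        1 / 40 * min (Real.logb 2 (m / s)) (n / Real.logb 2 s) ≤ t} := by
  set R := 1 / 40 * min (Real.logb 2 (m / s)) (n / Real.logb 2 s) with hR
  let hard : Set (Matrix (Fin m) (Fin n) (ZMod 2)) := {M | ∀ t : ℕ, HasCellProbeDS M s t → R ≤ t}
  change _ ≤ (hard.ncard : ℝ)
  obtain hR0 | hR0 := le_or_gt R 0
  · have hall : hard = Set.univ := Set.eq_univ_of_forall fun M t _ => hR0.trans t.cast_nonneg
    rw [hall, Set.ncard_univ]
    exact mul_le_of_le_one_left (Nat.cast_nonneg _) (by linarith)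
  obtain ⟨t, ht⟩ := Nat.exists_eq_add_one_of_ne_zero (Nat.ceil_pos.mpr hR0).ne'
  have htR : t < R := Nat.lt_ceil.mp (ht ▸ t.lt_succ_self)
  have hmin : ((40 * t : ℕ) : ℝ) < min (Real.logb 2 (m / s)) (n / Real.logb 2 s) := by
    push_cast
    linarith
  have hsub : {M : Matrix (Fin m) (Fin n) (ZMod 2) | ¬ HasCellProbeDS M s t} ⊆ hard := by
    intro M hM t' ht'
    have htt' : t < t' := lt_of_not_ge fun hle => hM (ht'.mono hle)
    exact Nat.ceil_le.mp (ht.trans_le htt')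
  calc (1 - δ) * Nat.card (Matrix (Fin m) (Fin n) (ZMod 2))
      ≤ {M : Matrix (Fin m) (Fin n) (ZMod 2) | ¬ HasCellProbeDS M s t}.ncard :=
        one_sub_mul_card_le_ncard_not_hasCellProbeDS hδ hs hδs
          (mul_two_pow_lt_of_lt_logb_div (by omega) (hmin.trans_le (min_le_left _ _)))
          (pow_lt_two_pow_of_lt_div_logb hs (hmin.trans_le (min_le_right _ _)))
    _ ≤ hard.ncard := by exact_mod_cast Set.ncard_le_ncard hsub

end CellProbe

theorem theorem3p1_general :
    (∀ (n t s m : ℕ) (S : Finset (Fin n → ZMod 2)), 1 ≤ t → 2 ≤ s →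
      32 * ((s : ℝ) * 2 ^ t) ≤ m → 40 * (t : ℝ) * Real.logb 2 s ≤ Real.logb 2 S.card →
      ∃ M : Matrix (Fin m) (Fin n) (ZMod 2),
        (∀ i, M i ∈ S) ∧ (m ≤ S.card → Function.Injective M) ∧ ¬ HasCellProbeDS M s t) ∧
    (∀ δ : ℝ, 0 < δ → ∃ K : ℕ, ∀ n m s : ℕ, K ≤ s →
      (1 - δ) * Nat.card (Matrix (Fin m) (Fin n) (ZMod 2)) ≤
        Nat.card {M : Matrix (Fin m) (Fin n) (ZMod 2) // ∀ t : ℕ, HasCellProbeDS M s t →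
          1 / 40 * min (Real.logb 2 (m / s)) (n / Real.logb 2 s) ≤ (t : ℝ)}) := by
  refine ⟨fun n t s m S ht hs hm hS => ?_, fun δ hδ => ?_⟩
  · refine exists_not_hasCellProbeDS ht hs (by exact_mod_cast hm) ?_
    exact pow_le_of_mul_logb_le_logb (by omega) hs (by exact_mod_cast hS)
  · refine ⟨max 2 ⌈1 / δ ^ 2⌉₊, fun n m s hs => ?_⟩
    obtain ⟨hs2, hsδ⟩ := max_le_iff.mp hs
    exact one_sub_mul_card_le_card_forall_hasCellProbeDS_imp_le hδ hs2 (Nat.ceil_le.mp hsδ)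

theorem theorem3p1 :
    -- hard choices of `m` linear functions inside any large enough collection `S`
    (∃ C : ℝ, ∀ (n t s m : ℕ) (S : Finset (Fin n → ZMod 2)),
      100 ≤ t → 100 ≤ s → 100 ≤ m →
      C * ((s : ℝ) * 2 ^ (3 * t)) ≤ (m : ℝ) →
      40 * (t : ℝ) * Real.logb 2 (s : ℝ) ≤ Real.logb 2 (S.card : ℝ) →
      ∃ M : Matrix (Fin m) (Fin n) (ZMod 2),
        (∀ i, M i ∈ S) ∧ (m ≤ S.card → Function.Injective M) ∧ ¬ HasCellProbeDS M s t) ∧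
    -- a uniformly random operator is hard with probability `1 - o(1)` as `s → ∞`
    (∃ c : ℝ, 0 < c ∧ ∀ δ : ℝ, 0 < δ → ∃ K : ℕ, ∀ n m s : ℕ, K ≤ s →
      (1 - δ) * (Nat.card (Matrix (Fin m) (Fin n) (ZMod 2)) : ℝ) ≤
        (Nat.card {M : Matrix (Fin m) (Fin n) (ZMod 2) // ∀ t : ℕ, HasCellProbeDS M s t →
          c * min (Real.logb 2 ((m : ℝ) / (s : ℝ))) ((n : ℝ) / Real.logb 2 (s : ℝ)) ≤ (t : ℝ)} : ℝ)) := by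
  exact ⟨⟨32, fun n t s m S ht hs _ hm => theorem3p1_general.1 n t s m S (by omega) (by omega)
    (hm.trans' (by gcongr <;> [norm_num; omega]))⟩, 1 / 40, by norm_num, theorem3p1_general.2⟩
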